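/- Consider a finite Markov decision process with finite state space $\mathcal S$, finite nonempty action space $\mathcal A$, transition probabilities $p(s'\mid s,a)$, expected rewards $R(s,a)\in\mathbb R$, discount factor $\gamma\in[0,1)$ and initial distribution $d_0$. A policy is a stationary randomized policy $\pi(a\mid s)$, and $P^\pi(s'\mid s)=\sum_a\pi(a\mid s)p(s'\mid s,a)$. Let $V^\pi(s)$ and $Q^\pi(s,a)$ be the expected discounted returns $\mathbb E_\pi[\sum_{t\ge 0}\gamma^tR_t]$ from $s$ and from $(s,a)$, and let $J(\pi)=\sum_s d_0(s)V^\pi(s)$; a policy is optimal if it maximizes $J$ over all policies. Assume one of the following. (Continuing setting) $P^\pi$ is irreducible for every policy $\pi$; $d_\pi$ is its stationary distribution. (Episodic setting) There is an absorbing state $z$ with $p(z\mid z,a)=1$, $R(z,a)=0$ for all $a$, which under every policy and from every state is reached eventually with probability one; $d_0(z)=0$ and $d_0(s)>0$ for all $s\ne z$; $d_\pi(z)=0$, and on $\mathcal S\setminus\{z\}$ the probability distribution $d_\pi$ is proportional to the expected number of visits $\sum_{t\ge0}\Pr_\pi(s_t=s\mid s_0\sim d_0)$. Use the tabular softmax parameterization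 $\pi_\theta(a\mid s)=e^{\theta_{s,a}}/\sum_{a'}e^{\theta_{s,a'}}$, $\theta\in\mathbb R^{\mathcal S\times\mathcal A}$, and the biased policy gradient $$\hat\nabla^{\mathrm e}J(\theta)=\mathbb E_{s\sim d_{\pi_\theta},\,a\sim\pi_\theta(\cdot\mid s)}\big[\nabla_\theta\ln\pi_\theta(a\mid s)\,Q^{\pi_\theta}(s,a)\big].$$ Let $0<\eta\le(1-\gamma)^2/8$, let $\theta_0$ be arbitrary and $\theta_{t+1}=\theta_t+\eta\,\hat\nabla^{\mathrm e}J(\theta_t)$. Then $\pi_{\theta_t}$ converges asymptotically to optimality, in the following sense. 1. There is an optimal policy $\pi_*$, with $V^{\pi_*}(s)=\max_\pi V^\pi(s)$ for every $s$, such that $V^{\pi_{\theta_t}}(s)\to V^{\pi_*}(s)$ for every $s\in\mathcal S$ and $J(\pi_{\theta_t})\to J(\pi_*)$ as $t\to\infty$. 2. The distance of $\pi_{\theta_t}$ to the set of optimal policies tends to $0$. 3. At every state $s$ at which all optimal policies have the same action distribution $\pi_*(\cdot\mid s)$, $\pi_{\theta_t}(\cdot\mid s)\to\pi_*(\cdot\mid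 s)$; in particular $\pi_{\theta_t}\to\pi_*$ if the optimal policy is unique. -/

import Mathlib

open Filter Topology Matrix

/-- A finite discounted Markov decision process with state space `S` and action space `A`:
transition probabilities `p s a s'`, expected rewards `R s a`, discount factor `γ ∈ [0, 1)` and
initial state distribution `d0`. -/
structure FiniteMDP (S A : Type*) [Fintype S] [Fintype A] where
  p : S → A → S → ℝ
  p_mem : ∀ s a, p s a ∈ stdSimplex ℝ S
  R : S → A → ℝ
  γ : ℝ
  γ_nonneg : 0 ≤ γ
  γ_lt_one : γ < 1
  d0 : S → ℝ
  d0_mem : d0 ∈ stdSimplex ℝ S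

/-- A (stationary, randomized) policy: `π s a` is the probability of action `a` in state `s`. -/
def IsPolicy {S A : Type*} [Fintype A] (π : S → A → ℝ) : Prop :=
  ∀ s, π s ∈ stdSimplex ℝ A

/-- The tabular softmax policy with parameters `θ (s, a)`. -/
noncomputable def softmaxPolicy {S A : Type*} [Fintype A]
    (θ : EuclideanSpace ℝ (S × A)) (s : S) (a : A) : ℝ :=
  Real.exp (θ (s, a)) / ∑ a', Real.exp (θ (s, a'))

namespace FiniteMDP

variable {S A : Type*} [Fintype S] [DecidableEq S] [Fintype A]

/-- The transition matrix `P^π` of the Markov chain induced by `π`. -/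
def transition (M : FiniteMDP S A) (π : S → A → ℝ) : Matrix S S ℝ :=
  Matrix.of fun s s' => ∑ a, π s a * M.p s a s'

/-- `E_π[R_t | s_0 = s]`. -/
def expReward (M : FiniteMDP S A) (π : S → A → ℝ) (t : ℕ) (s : S) : ℝ :=
  ∑ s', (M.transition π ^ t) s s' * ∑ a, π s' a * M.R s' a

/-- `E_π[R_t | s_0 = s, a_0 = a]`. -/
def expRewardOfAction (M : FiniteMDP S A) (π : S → A → ℝ) : ℕ → S → A → ℝ
  | 0, s, a => M.R s a
  | t + 1, s, a => ∑ s', M.p s a s' * M.expReward π t s'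

/-- State value function `V^π(s) = E_π[∑_t γ^t R_t | s]`. -/
noncomputable def value (M : FiniteMDP S A) (π : S → A → ℝ) (s : S) : ℝ :=
  ∑' t : ℕ, M.γ ^ t * M.expReward π t s

/-- State-action value function `Q^π(s, a) = E_π[∑_t γ^t R_t | s, a]`. -/
noncomputable def qValue (M : FiniteMDP S A) (π : S → A → ℝ) (s : S) (a : A) : ℝ :=
  ∑' t : ℕ, M.γ ^ t * M.expRewardOfAction π t s a

/-- The objective `J(π)`: expected discounted return from `s_0 ∼ d0`. -/
noncomputable def objective (M : FiniteMDP S A) (π : S → A → ℝ) : ℝ :=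
  ∑ s, M.d0 s * M.value π s

/-- `π` is an optimal policy: it maximizes `J` over all policies. -/
def IsOptimal (M : FiniteMDP S A) (π : S → A → ℝ) : Prop :=
  IsPolicy π ∧ ∀ π', IsPolicy π' → M.objective π' ≤ M.objective π

/-- Continuing setting: the chain of every policy is irreducible. -/
def IsContinuing (M : FiniteMDP S A) : Prop :=
  ∀ π, IsPolicy π → (M.transition π).IsIrreducible

/-- Episodic setting with absorbing terminal state `z`, which carries no reward and no initial
mass, is reached eventually with probability one from every state under every policy, and such
that every other state has positive initial probability. -/
structure IsEpisodic (M : FiniteMDP S A) (z : S) : Prop where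
  absorbing : ∀ a, M.p z a z = 1
  reward_terminal : ∀ a, M.R z a = 0
  d0_terminal : M.d0 z = 0
  d0_pos : ∀ s, s ≠ z → 0 < M.d0 s
  reaches : ∀ π, IsPolicy π → ∀ s, Tendsto (fun t : ℕ => (M.transition π ^ t) s z) atTop (𝓝 1)

/-- `d` is a stationary distribution of the transition matrix `P`. -/
def IsStationaryDist (P : Matrix S S ℝ) (d : S → ℝ) : Prop :=
  d ∈ stdSimplex ℝ S ∧ d ᵥ* P = d

/-- Undiscounted state distribution in the continuing setting: the stationary distribution of
`P^π` (which exists and is unique when `P^π` is irreducible). -/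
noncomputable def continuingDist (M : FiniteMDP S A) (π : S → A → ℝ) : S → ℝ :=
  Classical.epsilon (IsStationaryDist (M.transition π))

/-- Expected number of visits `∑_t P(s_t = s)` to `s` when `s_0 ∼ d0` and `π` is followed. -/
noncomputable def visits (M : FiniteMDP S A) (π : S → A → ℝ) (s : S) : ℝ :=
  ∑' t : ℕ, (M.d0 ᵥ* M.transition π ^ t) s

/-- Undiscounted state distribution in the episodic setting: zero at the terminal state `z`,
proportional to the expected number of visits elsewhere, normalized to sum to one. -/
noncomputable def episodicDist (M : FiniteMDP S A) (z : S) (π : S → A → ℝ) (s : S) : ℝ :=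
  if s = z then 0 else M.visits π s / ∑ s' ∈ Finset.univ.erase z, M.visits π s'

/-- The biased policy gradient `E_{s ∼ d_π, a ∼ π(·|s)}[∇_θ ln π_θ(a|s) Q^π(s, a)]` at `π = π_θ`,
where `d` assigns to each policy its undiscounted state distribution. -/
noncomputable def biasedGradient (M : FiniteMDP S A) (d : (S → A → ℝ) → S → ℝ)
    (θ : EuclideanSpace ℝ (S × A)) : EuclideanSpace ℝ (S × A) :=
  ∑ s, ∑ a, (d (softmaxPolicy θ) s * softmaxPolicy θ s a) •
    (M.qValue (softmaxPolicy θ) s a •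
      gradient (fun ϑ : EuclideanSpace ℝ (S × A) => Real.log (softmaxPolicy ϑ s a)) θ)

/-- The iterates `θ_{t+1} = θ_t + η ∇̂ᵉ J(θ_t)` of the biased policy gradient method. -/
def IsBiasedPGIteration (M : FiniteMDP S A) (d : (S → A → ℝ) → S → ℝ) (η : ℝ)
    (θ : ℕ → EuclideanSpace ℝ (S × A)) : Prop :=
  ∀ t, θ (t + 1) = θ t + η • M.biasedGradient d (θ t)

/-- Asymptotic convergence of a sequence of policies to optimality.
* The values from every initial state, and the objective, converge to those of a policy that is
  optimal for `J` and for every initial state.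
* The policies converge to the set of optimal policies.
* Wherever all optimal policies prescribe the same action probabilities, the policies converge to
  these; in particular they converge to the optimal policy if there is only one. -/
def ConvergesToOptimal (M : FiniteMDP S A) (π : ℕ → S → A → ℝ) : Prop :=
  (∃ πopt, M.IsOptimal πopt ∧
    (∀ π', IsPolicy π' → ∀ s, M.value π' s ≤ M.value πopt s) ∧
    (∀ s, Tendsto (fun t => M.value (π t) s) atTop (𝓝 (M.value πopt s))) ∧
    Tendsto (fun t => M.objective (π t)) atTop (𝓝 (M.objective πopt))) ∧
  (∀ ε > 0, ∀ᶠ t in atTop, ∃ πopt, M.IsOptimal πopt ∧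
    ∀ s a, |π t s a - πopt s a| < ε) ∧
  (∀ πopt, M.IsOptimal πopt → ∀ s, (∀ π', M.IsOptimal π' → π' s = πopt s) →
    Tendsto (fun t => π t s) atTop (𝓝 (πopt s)))

end FiniteMDP

/-!
By the closed form of the softmax gradient (`FiniteMDP.biasedGradient_apply`), the biased gradient
step adds `c * π(a|s) * A(s, a)` to `θ (s, a)`, where `A` is the advantage function of the current
policy `π` and the step size `c = η * d_π(s)` depends on the state. So the method is a softmax
ascent along advantages, and it only matters that the weights `d_π(s)` are at most one and bounded
below by a positive constant that does not depend on `π`. The lower bound comes from compactness of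
the set of policies:
limits of stationary distributions are stationary distributions of irreducible chains, hence
positive (`FiniteMDP.IsContinuing.exists_le_stationaryDist`), and absorption in the episodic
setting happens at a uniform geometric rate, so that the expected numbers of visits are bounded
(`FiniteMDP.IsEpisodic.exists_visits_bound`). The terminal state has weight zero, but there all
advantages vanish.

The new policy is proportional to `π exp(c π A)`. Since `A exp(c π A) ≥ A` and the mean of `A` under
`π` is zero, the new policy has nonnegative expected advantage at every state, so the values
increase monotonically. This holds for every step size and every scale of the rewards, with a gain
at least proportional to `(π A)²` (`softmaxPolicy_gain`). Hence the values converge, and `π A` tends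
to zero. If an action had a positive advantage in the limit, then its probability would vanish
although its parameter increases; `limit_nonpos_of_softmax_ascent` excludes this by tracking the sum
of the parameters of the actions that could carry the remaining probability. So the limit of the
values cannot be improved by any action, and it is the optimal value function. The three
convergence statements follow by compactness (`FiniteMDP.convergesToOptimal_of_tendsto`).
-/

/-! ### Softmax ascent at a single state -/

/-- The core of `limit_nonpos_of_softmax_ascent`, for sequences that are close to their limits from
time `0` on. If action `b` has limiting advantage `L b > 0`, its parameter increases while its
probability vanishes, so some parameters must diverge to `+∞`. They cannot: among the actions with
nonpositive limiting advantage, let `G` consist of those with parameters bounded below. All other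
actions push the sum of the parameters of `G` downwards, so these parameters are bounded, and the
remaining actions are eventually dominated by `b`. -/
lemma not_pos_of_softmax_ascent_aux {A : Type*} [Fintype A]
    {θ X π : ℕ → A → ℝ} {Z c : ℕ → ℝ} {L : A → ℝ} {b : A} {δ B : ℝ}
    (hZ : ∀ t, 0 < Z t) (hπ : ∀ t a, π t a = Real.exp (θ t a) / Z t)
    (hπ_sum : ∀ t, ∑ a, π t a = 1) (hc : ∀ t, 0 ≤ c t)
    (hstep : ∀ t a, θ (t + 1) a = θ t a + c t * (π t a * X t a))
    (hX_sum : ∀ t, ∑ a, π t a * X t a = 0) (hδ : 0 < δ) (hB : 0 < B)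
    (hXb : ∀ t, δ ≤ X t b)
    (hX_pos : ∀ a, 0 < L a → ∀ t, 0 ≤ X t a)
    (hX_neg : ∀ a, L a < 0 → ∀ t, X t a ≤ 0 ∧ -B ≤ X t a)
    (hX_zero : ∀ a, L a = 0 → ∀ t, |X t a| ≤ δ / Fintype.card A)
    (hLb : 0 < L b)
    (hπ_zero : ∀ a, 0 < L a → Tendsto (fun t => π t a) atTop (𝓝 0)) : False := by
  classical
  have hK : (1 : ℝ) ≤ Fintype.card A := by
    exact_mod_cast Fintype.card_pos_iff.mpr ⟨b⟩
  have hπ_pos : ∀ t a, 0 < π t a := fun t a => by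
    rw [hπ]; exact div_pos (Real.exp_pos _) (hZ t)
  have hπ_le : ∀ {t a}, θ t a ≤ θ t b → π t a ≤ π t b := fun {t a} h => by
    rw [hπ, hπ]; exact div_le_div_of_nonneg_right (Real.exp_le_exp.mpr h) (hZ t).le
  have hb_mono : Monotone fun t => θ t b := monotone_nat_of_le_succ fun t => by
    have := mul_nonneg (hc t) (mul_nonneg (hπ_pos t b).le (hδ.le.trans (hXb t)))
    rw [hstep]; linarith
  set m := θ 0 b
  have hm : ∀ t, m ≤ θ t b := fun t => hb_mono (Nat.zero_le t)
  let G : Finset A := {a | L a ≤ 0 ∧ ∃ y, ∀ t, y ≤ θ t a}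
  -- An action that is neither better than average in the limit nor in `G` is eventually dominated
  -- by `b`, with a negligible contribution to the update.
  have hout : ∀ a, a ∉ G → L a ≤ 0 → ∀ᶠ t in atTop,
      θ t a ≤ θ t b ∧ -(π t a * X t a) ≤ π t b * (δ / Fintype.card A) := by
    intro a ha hLa
    have hunb : ∀ y, ∃ t, θ t a < y := by
      by_contra! h
      obtain ⟨y, hy⟩ := h
      exact ha (by simp only [G, Finset.mem_filter, Finset.mem_univ, true_and]; exact ⟨hLa, y, hy⟩)
    rcases hLa.lt_or_eq with hneg | hzero
    · have hanti : Antitone fun t => θ t a := antitone_nat_of_succ_le fun t => by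
        have := mul_nonneg (hc t) (mul_nonneg (hπ_pos t a).le (neg_nonneg.mpr (hX_neg a hneg t).1))
        rw [hstep]; linarith
      set r := δ / Fintype.card A / B
      have hr : 0 < r := by positivity
      obtain ⟨t₀, ht₀⟩ := hunb (min m (m + Real.log r))
      filter_upwards [eventually_ge_atTop t₀] with t ht
      have h1 := (hanti ht).trans ht₀.le
      refine ⟨(h1.trans (min_le_left _ _)).trans (hm t), ?_⟩
      have h2 : Real.exp (θ t a) ≤ Real.exp (θ t b) * r := by
        calc Real.exp (θ t a) ≤ Real.exp (m + Real.log r) :=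
              Real.exp_le_exp.mpr (h1.trans (min_le_right _ _))
          _ = Real.exp m * r := by rw [Real.exp_add, Real.exp_log hr]
          _ ≤ _ := by gcongr; exact hm t
      have h3 : π t a ≤ π t b * r := by
        rw [hπ, hπ, div_mul_eq_mul_div]
        exact div_le_div_of_nonneg_right h2 (hZ t).le
      calc -(π t a * X t a) = π t a * -X t a := by ring
        _ ≤ π t a * B := by
            have := (hπ_pos t a).le
            gcongr; linarith [(hX_neg a hneg t).2]
        _ ≤ π t b * r * B := by gcongr
        _ = _ := by simp only [r]; field_simp
    · obtain ⟨t₀, ht₀⟩ := hunb m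
      have hle : ∀ t ≥ t₀, θ t a ≤ θ t b := by
        intro t ht
        induction t, ht using Nat.le_induction with
        | base => exact ht₀.le.trans (hm _)
        | succ t _ ih =>
          rw [hstep, hstep]
          have h1 : π t a * X t a ≤ π t b * X t b := by
            have hXle : X t a ≤ X t b :=
              ((le_abs_self _).trans (hX_zero a hzero t)).trans
                ((div_le_self hδ.le hK).trans (hXb t))
            calc π t a * X t a ≤ π t a * X t b := by
                  have := (hπ_pos t a).le
                  gcongr
              _ ≤ π t b * X t b :=
                  mul_le_mul_of_nonneg_right (hπ_le ih) (hδ.le.trans (hXb t))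
          have := mul_le_mul_of_nonneg_left h1 (hc t)
          linarith
      filter_upwards [eventually_ge_atTop t₀] with t ht
      refine ⟨hle t ht, ?_⟩
      calc -(π t a * X t a) = π t a * -X t a := by ring
        _ ≤ π t a * (δ / Fintype.card A) := by
            have := (hπ_pos t a).le
            gcongr; exact (neg_le_abs _).trans (hX_zero a hzero t)
        _ ≤ _ := mul_le_mul_of_nonneg_right (hπ_le (hle t ht)) (by positivity)
  have hout' : ∀ᶠ t in atTop, ∀ a, a ∉ G → L a ≤ 0 →
      θ t a ≤ θ t b ∧ -(π t a * X t a) ≤ π t b * (δ / Fintype.card A) := by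
    refine eventually_all.mpr fun a => ?_
    by_cases ha : a ∈ G
    · exact Eventually.of_forall fun t h => absurd ha h
    by_cases hL : L a ≤ 0
    · filter_upwards [hout a ha hL] with t ht _ _ using ht
    · exact Eventually.of_forall fun t _ h => absurd h hL
  obtain ⟨T, hT⟩ := eventually_atTop.mp hout'
  have hbG : b ∉ G := by simp [G, hLb]
  -- The total parameter weight of `G` does not increase after time `T`.
  have hG_step : ∀ t ≥ T, ∑ a ∈ G, θ (t + 1) a ≤ ∑ a ∈ G, θ t a := by
    intro t ht
    have h1 : ∑ a ∈ G, θ (t + 1) a = ∑ a ∈ G, θ t a + c t * ∑ a ∈ G, π t a * X t a := by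
      rw [Finset.mul_sum, ← Finset.sum_add_distrib]
      exact Finset.sum_congr rfl fun a _ => hstep t a
    have h2 : ∑ a ∈ G, π t a * X t a + ∑ a ∈ Gᶜ, π t a * X t a = 0 := by
      rw [Finset.sum_add_sum_compl, hX_sum]
    have h3 : ∑ a ∈ Gᶜ.erase b, -(π t a * X t a) ≤
        ∑ a ∈ Gᶜ.erase b, π t b * (δ / Fintype.card A) := by
      refine Finset.sum_le_sum fun a ha => ?_
      have haG : a ∉ G := by simpa using (Finset.mem_erase.mp ha).2
      rcases le_or_gt (L a) 0 with hL | hL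
      · exact (hT t ht a haG hL).2
      · have h4 := mul_nonneg (hπ_pos t a).le (hX_pos a hL t)
        have h5 : 0 ≤ π t b * (δ / Fintype.card A) := by
          have := (hπ_pos t b).le
          positivity
        linarith
    have h4 : ∑ a ∈ Gᶜ.erase b, π t b * (δ / Fintype.card A) ≤ π t b * δ := by
      rw [Finset.sum_const, nsmul_eq_mul]
      have h5 : ((Gᶜ.erase b).card : ℝ) ≤ Fintype.card A := by
        exact_mod_cast Finset.card_le_univ _
      calc ((Gᶜ.erase b).card : ℝ) * (π t b * (δ / Fintype.card A))
          ≤ Fintype.card A * (π t b * (δ / Fintype.card A)) := by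
            have := (hπ_pos t b).le
            gcongr
        _ = π t b * δ := by field_simp
    have h5 : ∑ a ∈ Gᶜ, π t a * X t a =
        π t b * X t b + ∑ a ∈ Gᶜ.erase b, π t a * X t a :=
      (Finset.add_sum_erase _ _ (by simpa using hbG)).symm
    have h6 : π t b * δ ≤ π t b * X t b :=
      mul_le_mul_of_nonneg_left (hXb t) (hπ_pos t b).le
    rw [Finset.sum_neg_distrib] at h3
    have h7 : ∑ a ∈ G, π t a * X t a ≤ 0 := by linarith
    have := mul_nonpos_of_nonneg_of_nonpos (hc t) h7
    linarith
  have hG_le : ∀ t ≥ T, ∑ a ∈ G, θ t a ≤ ∑ a ∈ G, θ T a := by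
    intro t ht
    induction t, ht using Nat.le_induction with
    | base => exact le_rfl
    | succ t ht ih => exact (hG_step t ht).trans ih
  have hG_bdd : ∀ a, ∃ y, a ∈ G → ∀ t, y ≤ θ t a := fun a => by
    by_cases ha : a ∈ G
    · obtain ⟨y, hy⟩ := (Finset.mem_filter.mp ha).2.2
      exact ⟨y, fun _ => hy⟩
    · exact ⟨0, fun h => absurd h ha⟩
  choose y hy using hG_bdd
  -- Since `θ b` is bounded below, the normalizing constant grows as fast as `π b` decays.
  have hZ_inv : ∀ t, 1 / Z t ≤ π t b * Real.exp (-m) := fun t => by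
    rw [hπ, div_mul_eq_mul_div, ← Real.exp_add]
    refine div_le_div_of_nonneg_right ?_ (hZ t).le
    exact Real.one_le_exp (by linarith [hm t])
  -- Hence every action probability tends to zero.
  have hall : ∀ a, Tendsto (fun t => π t a) atTop (𝓝 0) := by
    intro a
    rcases lt_or_ge 0 (L a) with hL | hL
    · exact hπ_zero a hL
    by_cases ha : a ∈ G
    · set u := ∑ a ∈ G, θ T a - ∑ a' ∈ G.erase a, y a'
      have hu : ∀ t ≥ T, θ t a ≤ u := fun t ht => by
        have h1 := hG_le t ht
        rw [← Finset.add_sum_erase _ _ ha] at h1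
        have h2 : ∑ a' ∈ G.erase a, y a' ≤ ∑ a' ∈ G.erase a, θ t a' :=
          Finset.sum_le_sum fun a' ha' => hy a' (Finset.mem_of_mem_erase ha') t
        simp only [u]; linarith
      have hlim : Tendsto (fun t => Real.exp u * (π t b * Real.exp (-m))) atTop (𝓝 0) := by
        simpa using ((hπ_zero b hLb).mul_const (Real.exp (-m))).const_mul (Real.exp u)
      refine squeeze_zero' (Eventually.of_forall fun t => (hπ_pos t a).le) ?_ hlim
      filter_upwards [eventually_ge_atTop T] with t ht
      rw [hπ, div_eq_mul_one_div]
      have := (hZ t).le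
      exact mul_le_mul (Real.exp_le_exp.mpr (hu t ht)) (hZ_inv t) (by positivity) (by positivity)
    · refine squeeze_zero' (Eventually.of_forall fun t => (hπ_pos t a).le) ?_ (hπ_zero b hLb)
      filter_upwards [eventually_ge_atTop T] with t ht using hπ_le (hT t ht a ha hL).1
  have h0 : Tendsto (fun t => ∑ a, π t a) atTop (𝓝 (∑ _a : A, (0 : ℝ))) :=
    tendsto_finsetSum _ fun a _ => hall a
  simp only [hπ_sum, Finset.sum_const_zero] at h0
  exact one_ne_zero (tendsto_nhds_unique tendsto_const_nhds h0)

/-- Softmax ascent at a single state, where `X t` are the advantages of the actions at time `t`: if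
the advantages converge and the update directions `π X` vanish, then no action keeps a positive
advantage in the limit. Only nonnegativity of the step sizes `c` is needed. -/
lemma limit_nonpos_of_softmax_ascent {A : Type*} [Fintype A]
    {θ X π : ℕ → A → ℝ} {Z c : ℕ → ℝ} {L : A → ℝ}
    (hZ : ∀ t, 0 < Z t) (hπ : ∀ t a, π t a = Real.exp (θ t a) / Z t)
    (hπ_sum : ∀ t, ∑ a, π t a = 1) (hc : ∀ t, 0 ≤ c t)
    (hstep : ∀ t a, θ (t + 1) a = θ t a + c t * (π t a * X t a))
    (hX_sum : ∀ t, ∑ a, π t a * X t a = 0)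
    (hX : ∀ a, Tendsto (fun t => X t a) atTop (𝓝 (L a)))
    (hπX : ∀ a, Tendsto (fun t => π t a * X t a) atTop (𝓝 0)) (b : A) : L b ≤ 0 := by
  by_contra! hLb
  have hK : (0 : ℝ) < Fintype.card A := by
    exact_mod_cast Fintype.card_pos_iff.mpr ⟨b⟩
  have hπ_zero : ∀ a, 0 < L a → Tendsto (fun t => π t a) atTop (𝓝 0) := fun a ha => by
    have h := (hπX a).div (hX a) ha.ne'
    rw [zero_div] at h
    refine h.congr' ?_
    filter_upwards [(hX a).eventually (lt_mem_nhds ha)] with t ht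
    exact mul_div_cancel_right₀ _ ht.ne'
  set B : ℝ := 1 + ∑ a, |L a|
  have hB : ∀ a, |L a| < B := fun a => by
    have := Finset.single_le_sum (f := fun a => |L a|) (fun i _ => abs_nonneg _)
      (Finset.mem_univ a)
    simp only [B]; linarith
  have hev : ∀ᶠ t in atTop, L b / 2 < X t b ∧ ∀ a, (0 < L a → 0 ≤ X t a) ∧
      (L a < 0 → X t a ≤ 0 ∧ -B ≤ X t a) ∧
      (L a = 0 → |X t a| ≤ L b / 2 / Fintype.card A) := by
    refine ((hX b).eventually (lt_mem_nhds (half_lt_self hLb))).and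
      (eventually_all.mpr fun a => ?_)
    rcases lt_trichotomy (L a) 0 with h | h | h
    · filter_upwards [(hX a).eventually (gt_mem_nhds h),
        (hX a).eventually (lt_mem_nhds (neg_lt_of_abs_lt (hB a)))] with t h1 h2
      exact ⟨fun h' => absurd h' h.le.not_gt, fun _ => ⟨h1.le, h2.le⟩, fun h' => absurd h' h.ne⟩
    · have h0 : Tendsto (fun t => |X t a|) atTop (𝓝 0) := by
        simpa [h] using (hX a).abs
      filter_upwards [h0.eventually (gt_mem_nhds (by positivity :
        0 < L b / 2 / Fintype.card A))] with t ht
      exact ⟨fun h' => absurd h h'.ne', fun h' => absurd h h'.ne, fun _ => ht.le⟩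
    · filter_upwards [(hX a).eventually (lt_mem_nhds h)] with t ht
      exact ⟨fun _ => ht.le, fun h' => absurd h' h.le.not_gt, fun h' => absurd h' h.ne'⟩
  obtain ⟨T, hT⟩ := eventually_atTop.mp hev
  have hT' := fun t => hT (t + T) (Nat.le_add_left T t)
  exact not_pos_of_softmax_ascent_aux (θ := fun t => θ (t + T)) (X := fun t => X (t + T))
    (π := fun t => π (t + T)) (Z := fun t => Z (t + T)) (c := fun t => c (t + T)) (L := L) (b := b)
    (δ := L b / 2) (B := B) (fun t => hZ _) (fun t => hπ _) (fun t => hπ_sum _) (fun t => hc _)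
    (fun t a => by rw [← hstep, Nat.add_right_comm]) (fun t => hX_sum _) (by positivity)
    ((abs_nonneg _).trans_lt (hB b)) (fun t => (hT' t).1.le) (fun a h t => ((hT' t).2 a).1 h)
    (fun a h t => ((hT' t).2 a).2.1 h) (fun a h t => ((hT' t).2 a).2.2 h) hLb
    (fun a h => (hπ_zero a h).comp (tendsto_add_atTop_nat T))

/-! ### Bellman equations -/

namespace FiniteMDP
variable {S A : Type*} [Fintype S] [Fintype A]
  (M : FiniteMDP S A) {π : S → A → ℝ}

/-- One-step lookahead: the expected return of taking action `a` in state `s` when the discounted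
continuation is valued by `W`. -/
def lookahead (M : FiniteMDP S A) (W : S → ℝ) (s : S) (a : A) : ℝ :=
  M.R s a + M.γ * ∑ s', M.p s a s' * W s'

lemma transition_nonneg (hπ : IsPolicy π) (s s' : S) : 0 ≤ M.transition π s s' :=
  Finset.sum_nonneg fun a _ => mul_nonneg ((hπ s).1 a) ((M.p_mem s a).1 s')

lemma transition_row_sum (hπ : IsPolicy π) (s : S) : ∑ s', M.transition π s s' = 1 := by
  simp only [transition, Matrix.of_apply]
  rw [Finset.sum_comm]
  simp_rw [← Finset.mul_sum, (M.p_mem s _).2, mul_one]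
  exact (hπ s).2

lemma sum_policy_lookahead (W : S → ℝ) (s : S) :
    ∑ a, π s a * M.lookahead W s a =
      ∑ a, π s a * M.R s a + M.γ * ∑ s', M.transition π s s' * W s' := by
  simp only [lookahead, transition, Matrix.of_apply, mul_add, Finset.sum_add_distrib,
    Finset.sum_mul]
  congr 1
  rw [Finset.sum_comm, Finset.mul_sum]
  refine Finset.sum_congr rfl fun a _ => ?_
  simp only [Finset.mul_sum]
  exact Finset.sum_congr rfl fun s' _ => by ring

/-- A bound on the absolute values of all expected rewards. -/
noncomputable def rewardBound (M : FiniteMDP S A) : ℝ := ∑ s, ∑ a, |M.R s a|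

lemma abs_R_le (s : S) (a : A) : |M.R s a| ≤ M.rewardBound :=
  (Finset.single_le_sum (f := fun a => |M.R s a|) (fun _ _ => abs_nonneg _)
    (Finset.mem_univ a)).trans
  (Finset.single_le_sum (f := fun s => ∑ a, |M.R s a|)
    (fun _ _ => Finset.sum_nonneg fun _ _ => abs_nonneg _) (Finset.mem_univ s))

lemma _root_.abs_sum_mul_le_of_stdSimplex {ι : Type*} [Fintype ι] {w f : ι → ℝ} {B : ℝ}
    (hw : w ∈ stdSimplex ℝ ι) (hf : ∀ i, |f i| ≤ B) : |∑ i, w i * f i| ≤ B := by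
  calc |∑ i, w i * f i| ≤ ∑ i, |w i * f i| := Finset.abs_sum_le_sum_abs _ _
    _ ≤ ∑ i, w i * B := Finset.sum_le_sum fun i _ => by
        rw [abs_mul, abs_of_nonneg (hw.1 i)]
        exact mul_le_mul_of_nonneg_left (hf i) (hw.1 i)
    _ = B := by rw [← Finset.sum_mul, hw.2, one_mul]

lemma hasSum_rewardBound :
    HasSum (fun t => M.γ ^ t * M.rewardBound) (M.rewardBound / (1 - M.γ)) := by
  have := (hasSum_geometric_of_lt_one M.γ_nonneg M.γ_lt_one).mul_right M.rewardBound
  rwa [inv_mul_eq_div] at this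

/-- The maximum principle behind the comparison of value functions: the discounted transition
operator is a contraction for the maximum. -/
lemma nonpos_of_le_discount (hπ : IsPolicy π) {D : S → ℝ}
    (hD : ∀ s, D s ≤ M.γ * ∑ s', M.transition π s s' * D s') (s : S) : D s ≤ 0 := by
  obtain ⟨m, -, hm⟩ := Finset.exists_max_image Finset.univ D ⟨s, Finset.mem_univ s⟩
  have h1 : ∑ s', M.transition π m s' * D s' ≤ D m := by
    calc ∑ s', M.transition π m s' * D s' ≤ ∑ s', M.transition π m s' * D m :=
          Finset.sum_le_sum fun s' _ =>
            mul_le_mul_of_nonneg_left (hm s' (Finset.mem_univ _)) (M.transition_nonneg hπ m s')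
      _ = D m := by rw [← Finset.sum_mul, M.transition_row_sum hπ, one_mul]
  have h2 := (hD m).trans (mul_le_mul_of_nonneg_left h1 M.γ_nonneg)
  have h3 : D m ≤ 0 := by nlinarith [M.γ_lt_one]
  exact (hm s (Finset.mem_univ s)).trans h3

lemma lookahead_mono {W W' : S → ℝ} (h : ∀ s, W s ≤ W' s) (s : S) (a : A) :
    M.lookahead W s a ≤ M.lookahead W' s a := by
  have := Finset.sum_le_sum fun s' (_ : s' ∈ Finset.univ) =>
    mul_le_mul_of_nonneg_left (h s') ((M.p_mem s a).1 s')
  have := mul_le_mul_of_nonneg_left this M.γ_nonneg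
  simp only [lookahead]; linarith

lemma tendsto_lookahead {ι : Type*} {l : Filter ι} {W : ι → S → ℝ} {W' : S → ℝ}
    (h : ∀ s, Tendsto (fun i => W i s) l (𝓝 (W' s))) (s : S) (a : A) :
    Tendsto (fun i => M.lookahead (W i) s a) l (𝓝 (M.lookahead W' s a)) :=
  ((tendsto_finsetSum _ fun s' _ => (h s').const_mul _).const_mul _).const_add _

variable [DecidableEq S]

lemma transition_mem_rowStochastic (hπ : IsPolicy π) :
    M.transition π ∈ Matrix.rowStochastic ℝ S :=
  Matrix.mem_rowStochastic_iff_sum.mpr ⟨M.transition_nonneg hπ, M.transition_row_sum hπ⟩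

lemma transition_pow_nonneg (hπ : IsPolicy π) (t : ℕ) (s s' : S) :
    0 ≤ (M.transition π ^ t) s s' :=
  (Matrix.mem_rowStochastic_iff_sum.mp (pow_mem (M.transition_mem_rowStochastic hπ) t)).1 s s'

lemma transition_pow_row_sum (hπ : IsPolicy π) (t : ℕ) (s : S) :
    ∑ s', (M.transition π ^ t) s s' = 1 :=
  (Matrix.mem_rowStochastic_iff_sum.mp (pow_mem (M.transition_mem_rowStochastic hπ) t)).2 s

lemma expReward_zero (s : S) : M.expReward π 0 s = ∑ a, π s a * M.R s a := by
  simp [expReward, Matrix.one_apply]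

lemma expReward_succ (t : ℕ) (s : S) :
    M.expReward π (t + 1) s = ∑ s', M.transition π s s' * M.expReward π t s' := by
  change ((M.transition π ^ (t + 1)) *ᵥ fun s' => ∑ a, π s' a * M.R s' a) s =
    (M.transition π *ᵥ ((M.transition π ^ t) *ᵥ fun s' => ∑ a, π s' a * M.R s' a)) s
  rw [pow_succ', Matrix.mulVec_mulVec]

lemma abs_expReward_le (hπ : IsPolicy π) (t : ℕ) (s : S) :
    |M.expReward π t s| ≤ M.rewardBound :=
  abs_sum_mul_le_of_stdSimplex
    ⟨M.transition_pow_nonneg hπ t s, M.transition_pow_row_sum hπ t s⟩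
    fun s' => abs_sum_mul_le_of_stdSimplex (hπ s') (M.abs_R_le s')

lemma norm_discounted_expReward_le (hπ : IsPolicy π) (t : ℕ) (s : S) :
    ‖M.γ ^ t * M.expReward π t s‖ ≤ M.γ ^ t * M.rewardBound := by
  rw [norm_mul, norm_pow, Real.norm_of_nonneg M.γ_nonneg]
  exact mul_le_mul_of_nonneg_left (M.abs_expReward_le hπ t s) (pow_nonneg M.γ_nonneg t)

lemma summable_discounted_expReward (hπ : IsPolicy π) (s : S) :
    Summable fun t => M.γ ^ t * M.expReward π t s :=
  .of_norm_bounded M.hasSum_rewardBound.summable fun t =>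
    M.norm_discounted_expReward_le hπ t s

lemma abs_value_le (hπ : IsPolicy π) (s : S) :
    |M.value π s| ≤ M.rewardBound / (1 - M.γ) :=
  tsum_of_norm_bounded M.hasSum_rewardBound fun t => M.norm_discounted_expReward_le hπ t s

lemma hasSum_mul_value (hπ : IsPolicy π) (w : S → ℝ) :
    HasSum (fun t => M.γ ^ (t + 1) * ∑ s', w s' * M.expReward π t s')
      (M.γ * ∑ s', w s' * M.value π s') := by
  have h := (hasSum_sum (s := Finset.univ) fun s' _ =>
    ((M.summable_discounted_expReward hπ s').hasSum).mul_left (w s')).mul_left M.γ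
  refine h.congr_fun fun t => ?_
  rw [pow_succ', mul_assoc, Finset.mul_sum]
  congr 1
  exact Finset.sum_congr rfl fun s' _ => by ring

lemma qValue_eq_lookahead (hπ : IsPolicy π) (s : S) (a : A) :
    M.qValue π s a = M.lookahead (M.value π) s a := by
  have h := M.hasSum_mul_value hπ (M.p s a)
  have h' := (hasSum_nat_add_iff (f := fun t => M.γ ^ t * M.expRewardOfAction π t s a) 1).mp h
  simp only [Finset.sum_range_one, pow_zero, one_mul, expRewardOfAction.eq_1] at h'
  rw [qValue, h'.tsum_eq, lookahead, add_comm]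

/-- The Bellman equation. -/
lemma value_eq_sum_lookahead (hπ : IsPolicy π) (s : S) :
    M.value π s = ∑ a, π s a * M.lookahead (M.value π) s a := by
  have h := M.hasSum_mul_value hπ (M.transition π s)
  simp only [← expReward_succ] at h
  have h' := (hasSum_nat_add_iff (f := fun t => M.γ ^ t * M.expReward π t s) 1).mp h
  simp only [Finset.sum_range_one, pow_zero, one_mul, expReward_zero] at h'
  rw [value, h'.tsum_eq, sum_policy_lookahead, add_comm]

/-- A function that does not decrease under the Bellman operator of `π` is below the value of `π`.
-/
lemma le_value_of_le_lookahead (hπ : IsPolicy π) {W : S → ℝ}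
    (hW : ∀ s, W s ≤ ∑ a, π s a * M.lookahead W s a) (s : S) : W s ≤ M.value π s := by
  refine sub_nonpos.mp (M.nonpos_of_le_discount hπ (D := fun s => W s - M.value π s)
    (fun s => ?_) s)
  have h1 := hW s
  have h2 := M.value_eq_sum_lookahead hπ s
  rw [sum_policy_lookahead] at h1 h2
  simp only [mul_sub, Finset.sum_sub_distrib]
  linarith

lemma value_le_of_lookahead_le (hπ : IsPolicy π) {W : S → ℝ}
    (hW : ∀ s, ∑ a, π s a * M.lookahead W s a ≤ W s) (s : S) : M.value π s ≤ W s := by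
  refine sub_nonpos.mp (M.nonpos_of_le_discount hπ (D := fun s => M.value π s - W s)
    (fun s => ?_) s)
  have h1 := hW s
  have h2 := M.value_eq_sum_lookahead hπ s
  rw [sum_policy_lookahead] at h1 h2
  simp only [mul_sub, Finset.sum_sub_distrib]
  linarith

/-- If policies converge and their values converge, then the limit of the values is the value of
the limit, since it solves the Bellman equation. -/
lemma value_eq_of_tendsto {ι : Type*} {l : Filter ι} [l.NeBot] {π' : ι → S → A → ℝ} {W : S → ℝ}
    (hπ' : ∀ i, IsPolicy (π' i)) (hπ : IsPolicy π) (h : Tendsto π' l (𝓝 π))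
    (hW : ∀ s, Tendsto (fun i => M.value (π' i) s) l (𝓝 (W s))) (s : S) :
    M.value π s = W s := by
  have hB : ∀ s, W s = ∑ a, π s a * M.lookahead W s a := fun s => by
    refine tendsto_nhds_unique (hW s) ?_
    simp_rw [fun i => M.value_eq_sum_lookahead (hπ' i) s]
    refine tendsto_finsetSum _ fun a _ => Tendsto.mul ?_ (M.tendsto_lookahead hW s a)
    exact tendsto_pi_nhds.mp (tendsto_pi_nhds.mp h s) a
  exact le_antisymm (M.value_le_of_lookahead_le hπ (fun s => (hB s).ge) s)
    (M.le_value_of_le_lookahead hπ (fun s => (hB s).le) s)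

end FiniteMDP

/-! ### The softmax parameterization and the biased gradient -/

section Softmax
variable {S A : Type*} [Fintype A]

lemma sum_exp_pos [Nonempty A] (f : A → ℝ) : 0 < ∑ a, Real.exp (f a) :=
  Finset.sum_pos (fun _ _ => Real.exp_pos _) Finset.univ_nonempty

lemma softmaxPolicy_pos [Nonempty A] (θ : EuclideanSpace ℝ (S × A)) (s : S) (a : A) :
    0 < softmaxPolicy θ s a :=
  div_pos (Real.exp_pos _) (sum_exp_pos _)

lemma isPolicy_softmaxPolicy [Nonempty A] (θ : EuclideanSpace ℝ (S × A)) :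
    IsPolicy (softmaxPolicy θ) := fun s =>
  ⟨fun a => (softmaxPolicy_pos θ s a).le, by
    simp only [softmaxPolicy]
    rw [← Finset.sum_div, div_self (sum_exp_pos _).ne']⟩

/-- Shifting the parameters multiplies the action probabilities by exponential weights and
renormalizes. -/
lemma softmaxPolicy_of_add [Nonempty A] {θ θ' : EuclideanSpace ℝ (S × A)} {s : S} {u : A → ℝ}
    (h : ∀ a, θ' (s, a) = θ (s, a) + u a) (a : A) :
    softmaxPolicy θ' s a =
      softmaxPolicy θ s a * Real.exp (u a) / ∑ a', softmaxPolicy θ s a' * Real.exp (u a') := by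
  have hZ := sum_exp_pos fun a => θ (s, a)
  simp only [softmaxPolicy, h, Real.exp_add, div_mul_eq_mul_div, ← Finset.sum_div]
  rw [div_div_div_cancel_right₀ hZ.ne']

variable [Fintype S]

lemma hasGradientAt_log_softmaxPolicy [DecidableEq S] [DecidableEq A] [Nonempty A]
    (θ : EuclideanSpace ℝ (S × A)) (s : S) (a : A) :
    HasGradientAt (fun ϑ : EuclideanSpace ℝ (S × A) => Real.log (softmaxPolicy ϑ s a))
      (EuclideanSpace.single (s, a) 1 -
        ∑ a', softmaxPolicy θ s a' • EuclideanSpace.single (s, a') (1 : ℝ)) θ := by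
  have hcoord : ∀ i : S × A, HasGradientAt (fun ϑ : EuclideanSpace ℝ (S × A) => ϑ i)
      (EuclideanSpace.single i (1 : ℝ)) θ := fun i => by
    rw [hasGradientAt_iff_hasFDerivAt]
    refine (EuclideanSpace.proj (𝕜 := ℝ) i).hasFDerivAt.congr_fderiv ?_
    ext v
    simp [EuclideanSpace.inner_single_left]
  have hlog : (fun ϑ : EuclideanSpace ℝ (S × A) => Real.log (softmaxPolicy ϑ s a)) =
      fun ϑ => ϑ (s, a) - Real.log (∑ a', Real.exp (ϑ (s, a'))) := by
    funext ϑ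
    rw [softmaxPolicy, Real.log_div (Real.exp_pos _).ne' (sum_exp_pos _).ne', Real.log_exp]
  rw [hlog, hasGradientAt_iff_hasFDerivAt]
  have h1 := fun i => hasGradientAt_iff_hasFDerivAt.mp (hcoord i)
  have h2 := (h1 (s, a)).sub
    ((HasFDerivAt.fun_sum (u := Finset.univ) fun a' _ => (h1 (s, a')).exp).log
      (sum_exp_pos _).ne')
  refine h2.congr_fderiv ?_
  simp only [map_sub, map_sum, map_smul, softmaxPolicy, Finset.smul_sum, smul_smul]
  congr 1
  refine Finset.sum_congr rfl fun a' _ => ?_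
  rw [inv_mul_eq_div]

/-- The biased policy gradient of the softmax parameterization in closed form: state weight times
action probability times advantage. -/
lemma FiniteMDP.biasedGradient_apply [DecidableEq S] [Nonempty A] (M : FiniteMDP S A)
    (d : (S → A → ℝ) → S → ℝ) (θ : EuclideanSpace ℝ (S × A)) (s : S) (a : A) :
    M.biasedGradient d θ (s, a) = d (softmaxPolicy θ) s * (softmaxPolicy θ s a *
      (M.qValue (softmaxPolicy θ) s a -
        ∑ a', softmaxPolicy θ s a' * M.qValue (softmaxPolicy θ) s a')) := by
  classical
  generalize hπ : softmaxPolicy θ = π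
  simp only [biasedGradient, (hasGradientAt_log_softmaxPolicy θ _ _).gradient, hπ]
  rw [WithLp.ofLp_sum, Finset.sum_apply, Finset.sum_eq_single s]
  · simp only [WithLp.ofLp_sum, Finset.sum_apply, PiLp.smul_apply, PiLp.sub_apply,
      PiLp.single_apply, smul_eq_mul,
      Prod.mk.injEq, true_and, mul_ite, mul_one, mul_zero, Finset.sum_ite_eq, Finset.mem_univ,
      if_true, mul_sub, Finset.sum_sub_distrib, Finset.mul_sum]
    congr 1
    · exact (mul_assoc _ _ _).trans rfl
    · exact Finset.sum_congr rfl fun a' _ => by ring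
  · intro s' _ hs'
    simp [WithLp.ofLp_sum, Finset.sum_apply, hs'.symm]
  · simp

end Softmax

/-! ### Monotone improvement and optimality of the limit -/

/-- Exponential reweighting correlates positively with its exponent, with a quadratic gain as long
as the exponents stay bounded. -/
lemma mul_sq_le_mul_exp_sub_one {c x U : ℝ} (hc : 0 ≤ c) (hU : |c * x| ≤ U) :
    Real.exp (-U) * (c * x ^ 2) ≤ x * (Real.exp (c * x) - 1) := by
  have hU0 : 0 ≤ U := (abs_nonneg _).trans hU
  have hexp : Real.exp (-U) ≤ 1 := Real.exp_le_one_iff.mpr (by linarith)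
  rcases le_or_gt 0 x with hx | hx
  · have h1 : c * x ≤ Real.exp (c * x) - 1 := by linarith [Real.add_one_le_exp (c * x)]
    calc Real.exp (-U) * (c * x ^ 2) ≤ 1 * (c * x ^ 2) := by gcongr
      _ = x * (c * x) := by ring
      _ ≤ _ := mul_le_mul_of_nonneg_left h1 hx
  · have h1 : Real.exp (c * x) - 1 ≤ Real.exp (-U) * (c * x) := by
      have h2 : 1 - c * x ≤ Real.exp (-(c * x)) := by linarith [Real.add_one_le_exp (-(c * x))]
      have h3 : Real.exp (c * x) * (1 - c * x) ≤ 1 := by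
        calc _ ≤ Real.exp (c * x) * Real.exp (-(c * x)) := by gcongr
          _ = 1 := by rw [← Real.exp_add, add_neg_cancel, Real.exp_zero]
      have h4 : Real.exp (-U) ≤ Real.exp (c * x) := Real.exp_le_exp.mpr (neg_le_of_abs_le hU)
      have h5 : c * x ≤ 0 := mul_nonpos_of_nonneg_of_nonpos hc hx.le
      nlinarith
    calc Real.exp (-U) * (c * x ^ 2) = x * (Real.exp (-U) * (c * x)) := by ring
      _ ≤ _ := mul_le_mul_of_nonpos_left h1 hx.le

/-- The new probabilities after a softmax ascent step have nonnegative expected advantage, whatever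
the step size `c`; the gain controls the squares of the update directions. -/
lemma softmaxPolicy_gain {S A : Type*} [Fintype A] [Nonempty A]
    {θ θ' : EuclideanSpace ℝ (S × A)} {s : S} {X : A → ℝ} {c C U : ℝ} (hc : 0 ≤ c) (hcC : c ≤ C)
    (h : ∀ a, θ' (s, a) = θ (s, a) + c * (softmaxPolicy θ s a * X a))
    (hsum : ∑ a, softmaxPolicy θ s a * X a = 0) (hX : ∀ a, |X a| ≤ U) (a : A) :
    Real.exp (-(C * U)) * (Real.exp (-(C * U)) * (c * (softmaxPolicy θ s a * X a) ^ 2)) ≤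
      ∑ a, softmaxPolicy θ' s a * X a := by
  set π := softmaxPolicy θ s
  have hπ : ∀ a, 0 < π a := softmaxPolicy_pos θ s
  have hπ1 : ∑ a, π a = 1 := (isPolicy_softmaxPolicy θ s).2
  set u : A → ℝ := fun a => c * (π a * X a)
  have hu : ∀ a, |u a| ≤ C * U := fun a => by
    have h1 : π a ≤ 1 := hπ1 ▸ Finset.single_le_sum (fun a _ => (hπ a).le) (Finset.mem_univ a)
    have h2 : π a * |X a| ≤ 1 * U := mul_le_mul h1 (hX a) (abs_nonneg _) zero_le_one
    rw [one_mul] at h2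
    simp only [u, abs_mul, abs_of_nonneg hc, abs_of_nonneg (hπ a).le]
    exact mul_le_mul hcC h2 (mul_nonneg (hπ a).le (abs_nonneg _)) (hc.trans hcC)
  set Z := ∑ a, π a * Real.exp (u a)
  have hZ : 0 < Z := Finset.sum_pos (fun a _ => mul_pos (hπ a) (Real.exp_pos _))
    Finset.univ_nonempty
  have hZ_le : Z ≤ Real.exp (C * U) := by
    calc Z ≤ ∑ a, π a * Real.exp (C * U) := Finset.sum_le_sum fun a _ => by
          have := (hπ a).le
          gcongr; exact (le_abs_self _).trans (hu a)
      _ = _ := by rw [← Finset.sum_mul, hπ1, one_mul]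
  have hgain : ∑ a, softmaxPolicy θ' s a * X a =
      (∑ a, π a * X a * (Real.exp (u a) - 1)) / Z := by
    simp only [softmaxPolicy_of_add h, mul_sub, mul_one, Finset.sum_sub_distrib, hsum, sub_zero,
      Finset.sum_div]
    exact Finset.sum_congr rfl fun a _ => by simp only [π, u, Z]; ring
  have hterm := fun a => mul_sq_le_mul_exp_sub_one (x := π a * X a) hc (hu a)
  have hterm0 : ∀ a, 0 ≤ π a * X a * (Real.exp (u a) - 1) := fun a =>
    le_trans (by positivity) (hterm a)
  rw [hgain, le_div_iff₀ hZ]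
  have h0 : 0 ≤ Real.exp (-(C * U)) * (c * (π a * X a) ^ 2) := by positivity
  calc _ = Real.exp (-(C * U)) * Z * (Real.exp (-(C * U)) * (c * (π a * X a) ^ 2)) := by ring
    _ ≤ 1 * (Real.exp (-(C * U)) * (c * (π a * X a) ^ 2)) := by
        refine mul_le_mul_of_nonneg_right ?_ h0
        calc Real.exp (-(C * U)) * Z ≤ Real.exp (-(C * U)) * Real.exp (C * U) := by gcongr
          _ = 1 := by rw [← Real.exp_add, neg_add_cancel, Real.exp_zero]
    _ ≤ _ := by
        rw [one_mul]
        exact (hterm a).trans (Finset.single_le_sum (f := fun a => π a * X a *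
          (Real.exp (u a) - 1)) (fun a _ => hterm0 a) (Finset.mem_univ a))

lemma isCompact_setOf_isPolicy {S A : Type*} [Fintype A] :
    IsCompact {π : S → A → ℝ | IsPolicy π} := by
  have h := isCompact_univ_pi fun _ : S => isCompact_stdSimplex ℝ A
  simpa only [Set.pi, Set.mem_univ, true_imp_iff, IsPolicy] using h

namespace FiniteMDP
variable {S A : Type*} [Fintype S] [DecidableEq S] [Fintype A] (M : FiniteMDP S A)

lemma isOptimal_of_value_le {π : S → A → ℝ} (hπ : IsPolicy π)
    (h : ∀ π', IsPolicy π' → ∀ s, M.value π' s ≤ M.value π s) : M.IsOptimal π :=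
  ⟨hπ, fun π' hπ' => Finset.sum_le_sum fun s _ =>
    mul_le_mul_of_nonneg_left (h π' hπ' s) (M.d0_mem.1 s)⟩

/-- Policies converge to optimality if their values converge to a limit that no action improves. -/
lemma convergesToOptimal_of_tendsto {π : ℕ → S → A → ℝ} (hπ : ∀ t, IsPolicy (π t)) {W : S → ℝ}
    (hW : ∀ s, Tendsto (fun t => M.value (π t) s) atTop (𝓝 (W s)))
    (hopt : ∀ s a, M.lookahead W s a ≤ W s) : M.ConvergesToOptimal π := by
  have hle : ∀ π', IsPolicy π' → ∀ s, M.value π' s ≤ W s := fun π' hπ' =>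
    M.value_le_of_lookahead_le hπ' fun s => by
      calc ∑ a, π' s a * M.lookahead W s a ≤ ∑ a, π' s a * W s :=
            Finset.sum_le_sum fun a _ => mul_le_mul_of_nonneg_left (hopt s a) ((hπ' s).1 a)
        _ = W s := by rw [← Finset.sum_mul, (hπ' s).2, one_mul]
  -- Every subsequence has an accumulation point, and accumulation points have value `W`.
  have hlim : ∀ φ : ℕ → ℕ, StrictMono φ → ∃ π', M.IsOptimal π' ∧ (∀ s, M.value π' s = W s) ∧
      ∃ ψ : ℕ → ℕ, Tendsto (fun t => π (φ (ψ t))) atTop (𝓝 π') := by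
    intro φ hφ
    obtain ⟨π', hπ', ψ, hψ, hlim⟩ :=
      isCompact_setOf_isPolicy.tendsto_subseq (x := fun t => π (φ t)) fun t => hπ (φ t)
    have hval := M.value_eq_of_tendsto (fun t => hπ _) hπ' hlim fun s =>
      (hW s).comp (hφ.comp hψ).tendsto_atTop
    exact ⟨π', M.isOptimal_of_value_le hπ' fun π'' h s => (hle π'' h s).trans (hval s).ge,
      hval, ψ, hlim⟩
  have hset : ∀ ε > 0, ∀ᶠ t in atTop, ∃ πopt, M.IsOptimal πopt ∧
      ∀ s a, |π t s a - πopt s a| < ε := by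
    intro ε hε
    by_contra hcon
    obtain ⟨φ, hφ, hfar⟩ := extraction_of_frequently_atTop (not_eventually.mp hcon)
    obtain ⟨π', hopt', -, ψ, hψ⟩ := hlim φ hφ
    have hnear : ∀ᶠ t in atTop, ∀ s a, |π (φ (ψ t)) s a - π' s a| < ε :=
      eventually_all.mpr fun s => eventually_all.mpr fun a => by
        have := tendsto_pi_nhds.mp (tendsto_pi_nhds.mp hψ s) a
        exact this.eventually (Metric.ball_mem_nhds (π' s a) hε)
    obtain ⟨t, ht⟩ := hnear.exists
    exact hfar (ψ t) ⟨π', hopt', ht⟩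
  refine ⟨?_, hset, ?_⟩
  · obtain ⟨πopt, hopt', hval, -⟩ := hlim id strictMono_id
    refine ⟨πopt, hopt', fun π' hπ' s => (hle π' hπ' s).trans (hval s).ge,
      fun s => (hval s).symm ▸ hW s, ?_⟩
    exact tendsto_finsetSum _ fun s _ => ((hval s).symm ▸ hW s).const_mul _
  · intro πopt hopt' s huniq
    refine tendsto_pi_nhds.mpr fun a => Metric.tendsto_atTop'.mpr fun ε hε => ?_
    obtain ⟨T, hT⟩ := eventually_atTop.mp (hset ε hε)
    refine ⟨T, fun t ht => ?_⟩
    obtain ⟨π', hπ', hd⟩ := hT t ht.le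
    rw [Real.dist_eq, ← huniq π' hπ']
    exact hd s a

/-- Softmax ascent along advantages, with any bounded state-dependent step sizes, to optimality,
provided the step sizes are bounded away from zero at every state where the choice of the action
matters. -/
lemma convergesToOptimal_of_softmax_ascent [Nonempty A] {θ : ℕ → EuclideanSpace ℝ (S × A)}
    {c : ℕ → S → ℝ} {C : ℝ} (hc : ∀ t s, 0 ≤ c t s) (hC : ∀ t s, c t s ≤ C)
    (hstep : ∀ t s a, θ (t + 1) (s, a) = θ t (s, a) + c t s * (softmaxPolicy (θ t) s a *
      (M.lookahead (M.value (softmaxPolicy (θ t))) s a - M.value (softmaxPolicy (θ t)) s)))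
    (hpos : ∀ s, (∃ k > 0, ∀ t, k ≤ c t s) ∨
      ∀ t a, M.lookahead (M.value (softmaxPolicy (θ t))) s a =
        M.value (softmaxPolicy (θ t)) s) :
    M.ConvergesToOptimal fun t => softmaxPolicy (θ t) := by
  set π : ℕ → S → A → ℝ := fun t => softmaxPolicy (θ t)
  have hπ : ∀ t, IsPolicy (π t) := fun t => isPolicy_softmaxPolicy (θ t)
  set V : ℕ → S → ℝ := fun t => M.value (π t)
  set X : ℕ → S → A → ℝ := fun t s a => M.lookahead (V t) s a - V t s
  set N := M.rewardBound / (1 - M.γ)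
  have hVN : ∀ t s, |V t s| ≤ N := fun t => M.abs_value_le (hπ t)
  set U := M.rewardBound + M.γ * N + N
  have hXU : ∀ t s a, |X t s a| ≤ U := fun t s a => by
    have h1 := abs_sum_mul_le_of_stdSimplex (M.p_mem s a) (hVN t)
    have h2 : |M.γ * ∑ s', M.p s a s' * V t s'| ≤ M.γ * N := by
      rw [abs_mul, abs_of_nonneg M.γ_nonneg]
      exact mul_le_mul_of_nonneg_left h1 M.γ_nonneg
    calc |X t s a| ≤ |M.lookahead (V t) s a| + |V t s| := abs_sub _ _
      _ ≤ |M.R s a| + |M.γ * ∑ s', M.p s a s' * V t s'| + |V t s| := by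
          gcongr; exact abs_add_le _ _
      _ ≤ _ := by
          have := M.abs_R_le s a
          have := hVN t s
          simp only [U]; linarith
  have hXsum : ∀ t s, ∑ a, π t s a * X t s a = 0 := fun t s => by
    simp only [X, mul_sub, Finset.sum_sub_distrib, ← Finset.sum_mul, (hπ t s).2, one_mul]
    exact sub_eq_zero.mpr (M.value_eq_sum_lookahead (hπ t) s).symm
  set q := Real.exp (-(C * U)) with hq
  have hgain : ∀ t s a, q * (q * (c t s * (π t s a * X t s a) ^ 2)) ≤
      ∑ a, π (t + 1) s a * X t s a := fun t s a =>
    softmaxPolicy_gain (hc t s) (hC t s) (hstep t s) (hXsum t s) (hXU t s) a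
  have hback : ∀ t s, ∑ a, π (t + 1) s a * M.lookahead (V t) s a =
      V t s + ∑ a, π (t + 1) s a * X t s a := fun t s => by
    simp only [X, mul_sub, Finset.sum_sub_distrib, ← Finset.sum_mul, (hπ (t + 1) s).2, one_mul]
    ring
  have hmono : ∀ t s, V t s ≤ V (t + 1) s := fun t => by
    refine M.le_value_of_le_lookahead (hπ (t + 1)) fun s => ?_
    have h1 := hgain t s (Classical.arbitrary A)
    have h2 := hc t s
    have h3 : 0 ≤ q * (q * (c t s * (π t s (Classical.arbitrary A) *
      X t s (Classical.arbitrary A)) ^ 2)) := by positivity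
    rw [hback]
    linarith
  have hincr : ∀ t s a, q * (q * (c t s * (π t s a * X t s a) ^ 2)) ≤
      V (t + 1) s - V t s := fun t s a => by
    have h1 : ∑ a, π (t + 1) s a * M.lookahead (V t) s a ≤ V (t + 1) s := by
      rw [show V (t + 1) s = _ from M.value_eq_sum_lookahead (hπ (t + 1)) s]
      exact Finset.sum_le_sum fun a _ =>
        mul_le_mul_of_nonneg_left (M.lookahead_mono (hmono t) s a) ((hπ (t + 1) s).1 a)
    rw [hback] at h1
    linarith [hgain t s a]
  have hconv : ∀ s, ∃ w, Tendsto (fun t => V t s) atTop (𝓝 w) := fun s =>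
    ⟨_, tendsto_atTop_ciSup (monotone_nat_of_le_succ fun t => hmono t s)
      ⟨N, by rintro _ ⟨t, rfl⟩; exact (le_abs_self _).trans (hVN t s)⟩⟩
  choose W hW using hconv
  refine M.convergesToOptimal_of_tendsto hπ hW fun s a => ?_
  have hXlim : ∀ a, Tendsto (fun t => X t s a) atTop (𝓝 (M.lookahead W s a - W s)) := fun a =>
    (M.tendsto_lookahead hW s a).sub (hW s)
  rw [← sub_nonpos]
  rcases hpos s with ⟨k, hk, hkc⟩ | htriv
  · refine limit_nonpos_of_softmax_ascent (θ := fun t a => θ t (s, a)) (π := fun t => π t s)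
      (X := fun t => X t s) (c := fun t => c t s) (L := fun a => M.lookahead W s a - W s)
      (fun t => sum_exp_pos _) (fun t a => rfl) (fun t => (hπ t s).2) (fun t => hc t s)
      (fun t a => hstep t s a) (fun t => hXsum t s) hXlim (fun a => ?_) a
    have hdiff : Tendsto (fun t => (V (t + 1) s - V t s) / (q * q * k)) atTop (𝓝 0) := by
      have := (((hW s).comp (tendsto_add_atTop_nat 1)).sub (hW s)).div_const (q * q * k)
      simpa using this
    have hq0 : 0 < q := Real.exp_pos _
    have hsq : Tendsto (fun t => (π t s a * X t s a) ^ 2) atTop (𝓝 0) := by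
      refine squeeze_zero (fun t => sq_nonneg _) (fun t => ?_) hdiff
      rw [le_div_iff₀ (by positivity)]
      calc (π t s a * X t s a) ^ 2 * (q * q * k)
          = q * (q * (k * (π t s a * X t s a) ^ 2)) := by ring
        _ ≤ q * (q * (c t s * (π t s a * X t s a) ^ 2)) := by gcongr; exact hkc t
        _ ≤ _ := hincr t s a
    have habs := hsq.sqrt
    simp only [Real.sqrt_sq_eq_abs, Real.sqrt_zero] at habs
    exact (tendsto_zero_iff_abs_tendsto_zero _).mpr habs
  · refine le_of_eq (tendsto_nhds_unique (hXlim a) ?_)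
    simp only [X, V, π, htriv, sub_self]
    exact tendsto_const_nhds

end FiniteMDP

/-! ### Stationary distributions in the continuing setting -/

namespace FiniteMDP
variable {S A : Type*} [Fintype S] [Fintype A]

/-- A stochastic matrix has a stationary distribution: the absolute values of a left eigenvector
for the eigenvalue `1` again form an eigenvector. -/
lemma exists_isStationaryDist [DecidableEq S] [Nonempty S] {P : Matrix S S ℝ}
    (hP : P ∈ Matrix.rowStochastic ℝ S) : ∃ d, IsStationaryDist P d := by
  obtain ⟨hP0, hP1⟩ := Matrix.mem_rowStochastic_iff_sum.mp hP
  have hdet : (P - 1).det = 0 := Matrix.exists_mulVec_eq_zero_iff.mp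
    ⟨1, one_ne_zero, by
      rw [Matrix.sub_mulVec, (Matrix.mem_rowStochastic.mp hP).2, Matrix.one_mulVec, sub_self]⟩
  obtain ⟨v, hv0, hv⟩ := Matrix.exists_vecMul_eq_zero_iff.mpr hdet
  rw [Matrix.vecMul_sub, Matrix.vecMul_one, sub_eq_zero] at hv
  have hle : ∀ j ∈ Finset.univ, |v j| ≤ ∑ i, |v i| * P i j := fun j _ => by
    calc |v j| = |∑ i, v i * P i j| := by
          conv_lhs => rw [← hv]
          rfl
      _ ≤ ∑ i, |v i * P i j| := Finset.abs_sum_le_sum_abs _ _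
      _ = _ := Finset.sum_congr rfl fun i _ => by rw [abs_mul, abs_of_nonneg (hP0 i j)]
  have hsum : ∑ j, |v j| = ∑ j, ∑ i, |v i| * P i j := by
    rw [Finset.sum_comm]
    exact Finset.sum_congr rfl fun i _ => by rw [← Finset.mul_sum, hP1, mul_one]
  have heq := (Finset.sum_eq_sum_iff_of_le hle).mp hsum
  have hpos : 0 < ∑ j, |v j| := by
    obtain ⟨j, hj⟩ := Function.ne_iff.mp hv0
    exact Finset.sum_pos' (fun _ _ => abs_nonneg _) ⟨j, Finset.mem_univ j, abs_pos.mpr hj⟩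
  refine ⟨(∑ j, |v j|)⁻¹ • fun j => |v j|, ⟨fun j => ?_, ?_⟩, ?_⟩
  · exact mul_nonneg (inv_nonneg.mpr hpos.le) (abs_nonneg _)
  · simp only [Pi.smul_apply, smul_eq_mul, ← Finset.mul_sum]
    exact inv_mul_cancel₀ hpos.ne'
  · rw [Matrix.smul_vecMul]
    congr 1
    funext j
    exact (heq j (Finset.mem_univ j)).symm

lemma IsStationaryDist.pos [DecidableEq S] {P : Matrix S S ℝ} {d : S → ℝ}
    (hd : IsStationaryDist P d) (hP : P.IsIrreducible) (s : S) : 0 < d s := by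
  have hpow : ∀ k : ℕ, d ᵥ* P ^ k = d := fun k => by
    induction k with
    | zero => simp
    | succ k ih => rw [pow_succ, ← Matrix.vecMul_vecMul, ih, hd.2]
  obtain ⟨s₀, -, hs₀⟩ : ∃ s₀ ∈ Finset.univ, 0 < d s₀ := by
    by_contra! h
    have := Finset.sum_nonpos h
    rw [hd.1.2] at this
    exact absurd this (by norm_num)
  obtain ⟨k, -, hk⟩ := (Matrix.isIrreducible_iff_exists_pow_pos hP.nonneg).mp hP s₀ s
  rw [← hpow k]
  exact Finset.sum_pos' (fun i _ => mul_nonneg (hd.1.1 i) (Matrix.pow_apply_nonneg hP.nonneg k i s))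
    ⟨s₀, Finset.mem_univ _, mul_pos hs₀ hk⟩

lemma continuous_transition (M : FiniteMDP S A) : Continuous M.transition := by
  refine continuous_matrix fun s s' => ?_
  simp only [transition, Matrix.of_apply]
  fun_prop

/-- By compactness, stationary distributions are bounded below uniformly over all policies when
all policies induce irreducible chains. -/
lemma IsContinuing.exists_le_stationaryDist [DecidableEq S] {M : FiniteMDP S A}
    (hM : M.IsContinuing) (s : S) : ∃ k > 0, ∀ π, IsPolicy π → ∀ d,
      IsStationaryDist (M.transition π) d → k ≤ d s := by
  let K : Set ((S → A → ℝ) × (S → ℝ)) :=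
    {x | IsPolicy x.1 ∧ IsStationaryDist (M.transition x.1) x.2}
  have hK : IsCompact K := by
    have hcl : IsClosed {x : (S → A → ℝ) × (S → ℝ) | x.2 ᵥ* M.transition x.1 = x.2} :=
      isClosed_eq (continuous_snd.matrix_vecMul (M.continuous_transition.comp continuous_fst))
        continuous_snd
    convert (isCompact_setOf_isPolicy.prod (isCompact_stdSimplex ℝ S)).inter_right hcl using 1
    ext x
    exact ⟨fun hx => ⟨⟨hx.1, hx.2.1⟩, hx.2.2⟩, fun hx => ⟨hx.1.1, hx.1.2, hx.2⟩⟩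
  rcases K.eq_empty_or_nonempty with hE | hne
  · refine ⟨1, one_pos, fun π hπ d hd => ?_⟩
    have : (π, d) ∈ K := ⟨hπ, hd⟩
    simp [hE] at this
  · obtain ⟨x, hx, hmin⟩ := hK.exists_isMinOn hne
      (f := fun x => x.2 s) (by fun_prop)
    exact ⟨x.2 s, hx.2.pos (hM _ hx.1) s, fun π hπ d hd => hmin (show (π, d) ∈ K from ⟨hπ, hd⟩)⟩

lemma isStationaryDist_continuingDist [DecidableEq S] (M : FiniteMDP S A) {π : S → A → ℝ}
    (hπ : IsPolicy π) :
    IsStationaryDist (M.transition π) (M.continuingDist π) := by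
  have : Nonempty S := by
    by_contra h
    rw [not_nonempty_iff] at h
    simpa using M.d0_mem.2
  exact Classical.epsilon_spec (exists_isStationaryDist (M.transition_mem_rowStochastic hπ))

end FiniteMDP

/-! ### Expected visits in the episodic setting -/

namespace FiniteMDP
variable {S A : Type*} [Fintype S] [DecidableEq S] [Fintype A] {M : FiniteMDP S A} {z : S}

lemma IsEpisodic.transition_terminal (hM : M.IsEpisodic z) {π : S → A → ℝ} (hπ : IsPolicy π) :
    M.transition π z z = 1 := by
  simp only [transition, Matrix.of_apply, hM.absorbing, mul_one]
  exact (hπ z).2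

lemma IsEpisodic.monotone_pow_terminal (hM : M.IsEpisodic z) {π : S → A → ℝ} (hπ : IsPolicy π)
    (s : S) : Monotone fun t : ℕ => (M.transition π ^ t) s z :=
  monotone_nat_of_le_succ fun t => by
    rw [pow_succ, Matrix.mul_apply]
    calc (M.transition π ^ t) s z = (M.transition π ^ t) s z * M.transition π z z := by
          rw [hM.transition_terminal hπ, mul_one]
      _ ≤ _ := Finset.single_le_sum
          (f := fun s' => (M.transition π ^ t) s s' * M.transition π s' z)
          (fun s' _ => mul_nonneg (M.transition_pow_nonneg hπ t s s') (M.transition_nonneg hπ s' z))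
          (Finset.mem_univ z)

/-- By compactness of the set of policies, the terminal state is reached with probability more than
one half within a number of steps that does not depend on the policy. -/
lemma IsEpisodic.exists_uniform_time (hM : M.IsEpisodic z) :
    ∃ n : ℕ, ∀ π, IsPolicy π → ∀ s, 1 / 2 < (M.transition π ^ n) s z := by
  let O : ℕ → Set (S → A → ℝ) := fun n => {π | ∀ s, 1 / 2 < (M.transition π ^ n) s z}
  have hO : ∀ n, IsOpen (O n) := fun n => by
    simp only [O, Set.ofPred_forall]
    refine isOpen_iInter_of_finite fun s => isOpen_lt continuous_const ?_
    exact (M.continuous_transition.pow n).matrix_elem s z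
  have hcover : {π : S → A → ℝ | IsPolicy π} ⊆ ⋃ n, O n := fun π hπ => by
    have : ∀ᶠ n : ℕ in atTop, ∀ s, 1 / 2 < (M.transition π ^ n) s z :=
      eventually_all.mpr fun s => (hM.reaches π hπ s).eventually (lt_mem_nhds (by norm_num))
    exact Set.mem_iUnion.mpr this.exists
  obtain ⟨F, hF⟩ := isCompact_setOf_isPolicy.elim_finite_subcover O hO hcover
  refine ⟨F.sup id, fun π hπ s => ?_⟩
  obtain ⟨n, hn, hπn⟩ := Set.mem_iUnion₂.mp (hF hπ)
  exact (hπn s).trans_le (hM.monotone_pow_terminal hπ s (Finset.le_sup (f := id) hn))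

lemma state_dist_nonneg {π : S → A → ℝ} (hπ : IsPolicy π) (t : ℕ) (s : S) :
    0 ≤ (M.d0 ᵥ* M.transition π ^ t) s :=
  Finset.sum_nonneg fun s' _ => mul_nonneg (M.d0_mem.1 s') (M.transition_pow_nonneg hπ t s' s)

/-- Expected numbers of visits to nonterminal states are finite, with a bound on their sum that
does not depend on the policy. -/
lemma IsEpisodic.exists_visits_bound (hM : M.IsEpisodic z) :
    ∃ B : ℝ, ∀ π, IsPolicy π →
      (∀ s ≠ z, Summable fun t : ℕ => (M.d0 ᵥ* M.transition π ^ t) s) ∧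
      ∑ s ∈ Finset.univ.erase z, M.visits π s ≤ B := by
  obtain ⟨n, hn⟩ := hM.exists_uniform_time
  refine ⟨2 * n, fun π hπ => ?_⟩
  set x : ℕ → S → ℝ := fun t => M.d0 ᵥ* M.transition π ^ t
  have hx0 : ∀ t s, 0 ≤ x t s := state_dist_nonneg hπ
  have hx1 : ∀ t, ∑ s, x t s = 1 := fun t => by
    simp only [x, Matrix.vecMul, dotProduct]
    rw [Finset.sum_comm]
    simp_rw [← Finset.mul_sum, M.transition_pow_row_sum hπ t, mul_one]
    exact M.d0_mem.2
  set y : ℕ → ℝ := fun t => ∑ s ∈ Finset.univ.erase z, x t s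
  have hy : ∀ t, y t = 1 - x t z := fun t => by
    rw [← hx1 t, ← Finset.add_sum_erase _ _ (Finset.mem_univ z), add_sub_cancel_left]
  have hy0 : ∀ t, 0 ≤ y t := fun t => Finset.sum_nonneg fun s _ => hx0 t s
  have hy1 : ∀ t, y t ≤ 1 := fun t => by linarith [hy t, hx0 t z]
  -- In `n` steps, at least half of the nonterminal mass is absorbed.
  have hhalf : ∀ t, y (t + n) ≤ y t / 2 := fun t => by
    have h1 : x (t + n) z = ∑ s, x t s * (M.transition π ^ n) s z := by
      simp only [x, pow_add, ← Matrix.vecMul_vecMul]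
      rfl
    have hz : (M.transition π ^ n) z z = 1 := by
      refine le_antisymm ?_ ?_
      · rw [← M.transition_pow_row_sum hπ n z]
        exact Finset.single_le_sum (fun s _ => M.transition_pow_nonneg hπ n z s)
          (Finset.mem_univ z)
      · simpa using hM.monotone_pow_terminal hπ z (Nat.zero_le n)
    rw [← Finset.add_sum_erase _ _ (Finset.mem_univ z), hz, mul_one] at h1
    have h2 : y t * (1 / 2) ≤ ∑ s ∈ Finset.univ.erase z, x t s * (M.transition π ^ n) s z := by
      rw [Finset.sum_mul]
      exact Finset.sum_le_sum fun s _ => mul_le_mul_of_nonneg_left (hn π hπ s).le (hx0 t s)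
    linarith [hy t, hy (t + n)]
  have hsum : ∀ T, ∑ t ∈ Finset.range T, y t ≤ 2 * n := fun T => by
    have h1 : ∑ t ∈ Finset.range T, y t ≤ ∑ t ∈ Finset.range (n + T), y t :=
      Finset.sum_le_sum_of_subset_of_nonneg (Finset.range_mono (Nat.le_add_left T n))
        fun t _ _ => hy0 t
    rw [Finset.sum_range_add] at h1
    have h2 : ∑ t ∈ Finset.range n, y t ≤ n := by
      simpa using Finset.sum_le_sum fun t (_ : t ∈ Finset.range n) => hy1 t
    have h3 : ∑ t ∈ Finset.range T, y (n + t) ≤ ∑ t ∈ Finset.range T, y t / 2 :=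
      Finset.sum_le_sum fun t _ => by rw [add_comm]; exact hhalf t
    rw [← Finset.sum_div] at h3
    linarith
  have hys : Summable y := summable_of_sum_range_le hy0 hsum
  have hxs : ∀ s ≠ z, Summable fun t => x t s := fun s hs =>
    hys.of_nonneg_of_le (fun t => hx0 t s) fun t =>
      Finset.single_le_sum (fun s _ => hx0 t s) (Finset.mem_erase.mpr ⟨hs, Finset.mem_univ s⟩)
  refine ⟨hxs, ?_⟩
  have h : ∑ s ∈ Finset.univ.erase z, M.visits π s = ∑' t, y t :=
    (Summable.tsum_finsetSum fun s hs => hxs s (Finset.ne_of_mem_erase hs)).symm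
  rw [h]
  exact Real.tsum_le_of_sum_range_le hy0 hsum

lemma IsEpisodic.d0_le_visits (hM : M.IsEpisodic z) {π : S → A → ℝ} (hπ : IsPolicy π) {s : S}
    (hs : s ≠ z) : M.d0 s ≤ M.visits π s := by
  obtain ⟨B, hB⟩ := hM.exists_visits_bound
  have := ((hB π hπ).1 s hs).le_tsum 0 fun t _ => state_dist_nonneg hπ t s
  simpa [visits] using this

lemma visits_nonneg {π : S → A → ℝ} (hπ : IsPolicy π) (s : S) : 0 ≤ M.visits π s :=
  tsum_nonneg fun t => state_dist_nonneg hπ t s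

lemma episodicDist_nonneg {π : S → A → ℝ} (hπ : IsPolicy π) (s : S) :
    0 ≤ M.episodicDist z π s := by
  unfold episodicDist
  split_ifs
  · exact le_rfl
  · exact div_nonneg (visits_nonneg hπ s) (Finset.sum_nonneg fun s _ => visits_nonneg hπ s)

lemma episodicDist_le_one {π : S → A → ℝ} (hπ : IsPolicy π) (s : S) :
    M.episodicDist z π s ≤ 1 := by
  unfold episodicDist
  split_ifs with h
  · exact zero_le_one
  · exact div_le_one_of_le₀ (Finset.single_le_sum (fun s _ => visits_nonneg hπ s)
      (Finset.mem_erase.mpr ⟨h, Finset.mem_univ s⟩))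
      (Finset.sum_nonneg fun s _ => visits_nonneg hπ s)

/-- Nonterminal states have weights bounded below uniformly over all policies. -/
lemma IsEpisodic.exists_le_episodicDist (hM : M.IsEpisodic z) {s : S} (hs : s ≠ z) :
    ∃ k > 0, ∀ π, IsPolicy π → k ≤ M.episodicDist z π s := by
  obtain ⟨B, hB⟩ := hM.exists_visits_bound
  have hd := hM.d0_pos s hs
  refine ⟨M.d0 s / max B 1, by positivity, fun π hπ => ?_⟩
  have hv := hM.d0_le_visits hπ hs
  have hsum : M.visits π s ≤ ∑ s' ∈ Finset.univ.erase z, M.visits π s' :=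
    Finset.single_le_sum (fun s _ => visits_nonneg hπ s)
      (Finset.mem_erase.mpr ⟨hs, Finset.mem_univ s⟩)
  rw [episodicDist, if_neg hs]
  exact div_le_div₀ (hd.le.trans hv) hv (hd.trans_le (hv.trans hsum))
    ((hB π hπ).2.trans (le_max_left _ _))

lemma IsEpisodic.lookahead_terminal (hM : M.IsEpisodic z) (W : S → ℝ) (a : A) :
    M.lookahead W z a = M.γ * W z := by
  have h0 : ∀ s ∈ Finset.univ, s ≠ z → M.p z a s * W s = 0 := fun s _ hs => by
    have h1 := (M.p_mem z a).2
    rw [← Finset.add_sum_erase _ _ (Finset.mem_univ z), hM.absorbing, add_eq_left] at h1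
    rw [(Finset.sum_eq_zero_iff_of_nonneg fun s _ => (M.p_mem z a).1 s).mp h1 s
      (Finset.mem_erase.mpr ⟨hs, Finset.mem_univ s⟩), zero_mul]
  rw [lookahead, hM.reward_terminal, zero_add, Finset.sum_eq_single z h0 (by simp),
    hM.absorbing, one_mul]

lemma IsEpisodic.value_terminal (hM : M.IsEpisodic z) {π : S → A → ℝ} (hπ : IsPolicy π) :
    M.value π z = 0 := by
  have h := M.value_eq_sum_lookahead hπ z
  simp only [hM.lookahead_terminal, ← Finset.sum_mul, (hπ z).2, one_mul] at h
  have : (1 - M.γ) * M.value π z = 0 := by linarith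
  exact (mul_eq_zero.mp this).resolve_left (sub_pos.mpr M.γ_lt_one).ne'

/-! ### Convergence of the biased policy gradient method -/

/-- The biased gradient step is a softmax ascent step along the advantages, with the step size at
each state proportional to its weight. -/
lemma IsBiasedPGIteration.step [Nonempty A] {d : (S → A → ℝ) → S → ℝ} {η : ℝ}
    {θ : ℕ → EuclideanSpace ℝ (S × A)} (h : M.IsBiasedPGIteration d η θ) (t : ℕ) (s : S) (a : A) :
    θ (t + 1) (s, a) = θ t (s, a) + η * d (softmaxPolicy (θ t)) s * (softmaxPolicy (θ t) s a *
      (M.lookahead (M.value (softmaxPolicy (θ t))) s a - M.value (softmaxPolicy (θ t)) s)) := by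
  have hπ := isPolicy_softmaxPolicy (θ t)
  rw [h t, PiLp.add_apply, PiLp.smul_apply, biasedGradient_apply, smul_eq_mul, mul_assoc η]
  simp only [M.qValue_eq_lookahead hπ]
  rw [← M.value_eq_sum_lookahead hπ s]

end FiniteMDP

theorem theorem2 {S A : Type*} [Fintype S] [DecidableEq S] [Fintype A] [Nonempty A]
    (M : FiniteMDP S A) (η : ℝ) (hη_pos : 0 < η) (hη : η ≤ (1 - M.γ) ^ 2 / 8)
    (θ : ℕ → EuclideanSpace ℝ (S × A)) :
    (M.IsContinuing → M.IsBiasedPGIteration M.continuingDist η θ →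
      M.ConvergesToOptimal fun t => softmaxPolicy (θ t)) ∧
    (∀ z, M.IsEpisodic z → M.IsBiasedPGIteration (M.episodicDist z) η θ →
      M.ConvergesToOptimal fun t => softmaxPolicy (θ t)) := by
  have hπ := fun t => isPolicy_softmaxPolicy (θ t)
  refine ⟨fun hM hθ => ?_, fun z hM hθ => ?_⟩
  · have hd := fun t => M.isStationaryDist_continuingDist (hπ t)
    refine M.convergesToOptimal_of_softmax_ascent (C := η)
      (fun t s => mul_nonneg hη_pos.le ((hd t).1.1 s)) (fun t s => ?_) hθ.step fun s => .inl ?_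
    · refine mul_le_of_le_one_right hη_pos.le ?_
      rw [← (hd t).1.2]
      exact Finset.single_le_sum (fun s _ => (hd t).1.1 s) (Finset.mem_univ s)
    · obtain ⟨k, hk, hle⟩ := hM.exists_le_stationaryDist s
      exact ⟨η * k, mul_pos hη_pos hk, fun t =>
        mul_le_mul_of_nonneg_left (hle _ (hπ t) _ (hd t)) hη_pos.le⟩
  · refine M.convergesToOptimal_of_softmax_ascent (C := η)
      (fun t s => mul_nonneg hη_pos.le (FiniteMDP.episodicDist_nonneg (hπ t) s))
      (fun t s => mul_le_of_le_one_right hη_pos.le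
        (FiniteMDP.episodicDist_le_one (hπ t) s)) hθ.step fun s => ?_
    rcases eq_or_ne s z with rfl | hs
    · refine .inr fun t a => ?_
      rw [hM.lookahead_terminal, hM.value_terminal (hπ t), mul_zero]
    · obtain ⟨k, hk, hle⟩ := hM.exists_le_episodicDist hs
      exact .inl ⟨η * k, mul_pos hη_pos hk, fun t =>
        mul_le_mul_of_nonneg_left (hle _ (hπ t)) hη_pos.le⟩
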